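/- **Generalized Grothendieck inequality in tensor form.** Let $\mathcal{X},\mathcal{Y},\mathcal{A},\mathcal{B}$ be finite sets. Let $\ell_\infty^{|\mathcal{X}|}(\ell_1^{|\mathcal{A}|})$ be the real vector space of arrays $(P_A(x,a))_{x\in\mathcal{X},a\in\mathcal{A}}$ with the norm $\|P_A\|_{\infty(1)}=\max_{x\in\mathcal{X}}\sum_{a\in\mathcal{A}}|P_A(x,a)|$, and define $\ell_\infty^{|\mathcal{Y}|}(\ell_1^{|\mathcal{B}|})$ in the same way. For real normed spaces $E,F$ and $P$ in the algebraic tensor product $E\otimes F$ put $$\pi(P)=\inf\Big\{\sum_{i=1}^n\|u_i\|_E\,\|v_i\|_F\Big\},\qquad \gamma_2(P)=\inf\big\{w_2(u_1,\dots,u_n;E)\cdot w_2(v_1,\dots,v_n;F)\big\},$$ where both infima are over all $n$ and all finite decompositions $P=\sum_{i=1}^n u_i\otimes v_i$ with $u_i\in E$, $v_i\in F$, and $$w_2(u_1,\dots,u_n;E)=\sup\Big\{\Big(\sum_{i=1}^n|G(u_i)|^2\Big)^{1/2} : G\in E^*,\ \|G\|_{E^*}\le 1\Big\}.$$ Then for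 every $P\in\ell_\infty^{|\mathcal{X}|}(\ell_1^{|\mathcal{A}|})\otimes\ell_\infty^{|\mathcal{Y}|}(\ell_1^{|\mathcal{B}|})$, $$\pi(P)\le K\cdot\sqrt{|\mathcal{A}|\,|\mathcal{B}|}\cdot\gamma_2(P),\qquad K=\frac{\pi}{2\ln(1+\sqrt2)},$$ where the $\pi$ in $K$ is the number $3.14159\ldots$ -/

import Mathlib

open scoped TensorProduct ENNReal

noncomputable section

/-- The Banach space `ℓ_∞^X(ℓ_1^A)` of real arrays `(P x a)`, for finite index sets `X` and `A`,
with the norm `‖P‖ = max_x ∑_a |P x a|`. -/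
abbrev LInftyL1 (X A : Type*) [Fintype X] [Fintype A] : Type _ :=
  PiLp ∞ (fun _ : X => PiLp 1 (fun _ : A => ℝ))

/-- The projective tensor norm on the algebraic tensor product `E ⊗ F`:
`π(P) = inf { ∑ i, ‖u i‖ * ‖v i‖ : P = ∑ i, u i ⊗ v i }`,
the infimum being over all finite decompositions of `P`. -/
def projectiveTensorNorm {E F : Type*} [NormedAddCommGroup E] [NormedSpace ℝ E]
    [NormedAddCommGroup F] [NormedSpace ℝ F] (P : E ⊗[ℝ] F) : ℝ :=
  sInf {r : ℝ | ∃ (n : ℕ) (u : Fin n → E) (v : Fin n → F),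
    P = ∑ i, u i ⊗ₜ[ℝ] v i ∧ r = ∑ i, ‖u i‖ * ‖v i‖}

/-- The weak `2`-norm of a finite family `u` of vectors of `E`:
`w₂(u ; E) = sup { (∑ i, |G (u i)| ^ 2) ^ (1 / 2) : G ∈ E^*, ‖G‖ ≤ 1 }`,
where `E^*` carries the dual norm. -/
def weakTwoNorm {E : Type*} [NormedAddCommGroup E] [NormedSpace ℝ E]
    {n : ℕ} (u : Fin n → E) : ℝ :=
  sSup {r : ℝ | ∃ G : E →L[ℝ] ℝ, ‖G‖ ≤ 1 ∧ r = Real.sqrt (∑ i, |G (u i)| ^ 2)}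

/-- The Hilbertian tensor norm on the algebraic tensor product `E ⊗ F`:
`γ₂(P) = inf { w₂(u ; E) * w₂(v ; F) : P = ∑ i, u i ⊗ v i }`,
the infimum being over all finite decompositions of `P`. -/
def hilbertianTensorNorm {E F : Type*} [NormedAddCommGroup E] [NormedSpace ℝ E]
    [NormedAddCommGroup F] [NormedSpace ℝ F] (P : E ⊗[ℝ] F) : ℝ :=
  sInf {r : ℝ | ∃ (n : ℕ) (u : Fin n → E) (v : Fin n → F),
    P = ∑ i, u i ⊗ₜ[ℝ] v i ∧ r = weakTwoNorm u * weakTwoNorm v}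

end

open MeasureTheory ProbabilityTheory
open scoped RealInnerProductSpace

/-! Given `P = ∑ u i ⊗ v i`, the entries of `P` are inner products of the entry vectors `U (x, a)`
and `V (y, b)`. Grothendieck's inequality with Krivine's constant
(`exists_sign_representation_inner`) writes these products as `K` times an average, over sign
patterns, of products of signed norms. So `P` is `K` times a convex combination of elementary
tensors of arrays whose entries are bounded by `‖U (x, a)‖` and `‖V (y, b)‖`. It remains to bound `∑
a, ‖U (x, a)‖`. Cauchy–Schwarz costs `√|A|` and leaves the root of `∑ a, ‖U (x, a)‖ ^ 2`. Suitable
signs `ε` bound that sum by `‖∑ a, ε a • U (x, a)‖ ^ 2`, and `ε` acting on row `x` is a functional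
of norm at most `1`, so `w₂(u)` appears. Krivine's step: with `c = log (1 + √2)`, a Gaussian vector
with `krivineMatrix` as covariance has sign correlations `(2 / π) c ⟪·,·⟫` between the two blocks,
and `K = π / (2 c)`. -/

/-- For any finite family of vectors some choice of signs makes the signed sum at least as long
as the orthogonal sum. -/
theorem exists_signs_sum_norm_sq_le {α H : Type*} [NormedAddCommGroup H] [InnerProductSpace ℝ H]
    (s : Finset α) (U : α → H) :
    ∃ ε : α → ℝ, (∀ a, |ε a| ≤ 1) ∧ ∑ a ∈ s, ‖U a‖ ^ 2 ≤ ‖∑ a ∈ s, ε a • U a‖ ^ 2 := by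
  classical
  induction s using Finset.induction_on with
  | empty => exact ⟨fun _ => 0, by simp, by simp⟩
  | insert b s hb ih =>
    obtain ⟨ε, hε, h⟩ := ih
    obtain ⟨t, ht, hpos⟩ : ∃ t : ℝ, |t| = 1 ∧ 0 ≤ t * ⟪U b, ∑ a ∈ s, ε a • U a⟫ := by
      rcases le_total 0 ⟪U b, ∑ a ∈ s, ε a • U a⟫ with h0 | h0
      · exact ⟨1, by simp, by simpa using h0⟩
      · exact ⟨-1, by simp, by simpa using h0⟩
    refine ⟨Function.update ε b t, fun a => ?_, ?_⟩
    · rcases eq_or_ne a b with rfl | hab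
      · simp [ht]
      · simpa [hab] using hε a
    · have hs : ∑ a ∈ s, Function.update ε b t a • U a = ∑ a ∈ s, ε a • U a :=
        Finset.sum_congr rfl fun a ha => by
          rw [Function.update_of_ne (ne_of_mem_of_not_mem ha hb)]
      rw [Finset.sum_insert hb, Finset.sum_insert hb, hs, Function.update_self,
        norm_add_sq_real, norm_smul, real_inner_smul_left, Real.norm_eq_abs, ht]
      linarith

/-! ### Positivity of Krivine's matrix. -/

/-- Entrywise powers of a Gram matrix are positive semidefinite. -/
theorem sum_mul_inner_pow_nonneg {ι κ : Type*} [Fintype ι] [Fintype κ]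
    (p : ι → EuclideanSpace ℝ κ) (m : ℕ) (x : ι → ℝ) :
    0 ≤ ∑ i, ∑ j, x i * x j * ⟪p i, p j⟫ ^ m := by
  induction m generalizing x with
  | zero =>
    have : ∑ i, ∑ j, x i * x j * ⟪p i, p j⟫ ^ 0 = (∑ i, x i) ^ 2 := by
      simp [sq, Finset.sum_mul_sum]
    rw [this]
    positivity
  | succ m ih =>
    -- One inner product is expanded in coordinates and absorbed into the weights, which is why `x`
    -- is generalized.
    have : ∑ i, ∑ j, x i * x j * ⟪p i, p j⟫ ^ (m + 1) =
        ∑ l, ∑ i, ∑ j, (x i * p i l) * (x j * p j l) * ⟪p i, p j⟫ ^ m := by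
      rw [Finset.sum_comm]
      refine Eq.trans ?_ (Finset.sum_comm.trans (Finset.sum_congr rfl fun i _ => Finset.sum_comm)).symm
      rw [Finset.sum_comm]
      refine Finset.sum_congr rfl fun i _ => Finset.sum_congr rfl fun j _ => ?_
      rw [← Finset.sum_mul, pow_succ, mul_comm (_ ^ m), ← mul_assoc]
      congr 1
      rw [PiLp.inner_apply, Finset.mul_sum]
      refine Finset.sum_congr rfl fun l _ => ?_
      simp
      ring
    rw [this]
    exact Finset.sum_nonneg fun l _ => ih _

/-- The matrix with diagonal blocks `sinh (c ⟪·,·⟫)` and off-diagonal blocks `sin (c ⟪·,·⟫)`. -/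
noncomputable def krivineMatrix {I J κ : Type*} [Fintype κ] (c : ℝ) (p : I ⊕ J → EuclideanSpace ℝ κ) :
    Matrix (I ⊕ J) (I ⊕ J) ℝ :=
  fun i j => if i.isLeft = j.isLeft then Real.sinh (c * ⟪p i, p j⟫) else Real.sin (c * ⟪p i, p j⟫)

/-- The series of `sinh` and `sin` differ only by the signs `(-1) ^ k`, which a diagonal change of
signs removes term by term; what is left is a nonnegative combination of odd powers of a Gram
matrix. -/
theorem krivineMatrix_posSemidef {I J κ : Type*} [Fintype I] [Fintype J] [Fintype κ] {c : ℝ}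
    (hc : 0 ≤ c) (p : I ⊕ J → EuclideanSpace ℝ κ) : (krivineMatrix c p).PosSemidef := by
  refine Matrix.PosSemidef.of_dotProduct_mulVec_nonneg ?_ fun x => ?_
  · ext i j
    simp only [krivineMatrix, Matrix.conjTranspose_apply, star_trivial, real_inner_comm,
      eq_comm (a := i.isLeft)]
  -- `δ k i * δ k j` is `1` within a block and `(-1) ^ k` across blocks.
  set δ : ℕ → I ⊕ J → ℝ := fun k i => if i.isLeft then 1 else (-1) ^ k with hδ
  have hM (i j : I ⊕ J) : HasSum (fun k : ℕ => δ k i * δ k j *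
      ((c * ⟪p i, p j⟫) ^ (2 * k + 1) / (2 * k + 1).factorial)) (krivineMatrix c p i j) := by
    unfold krivineMatrix
    split_ifs with h
    · convert Real.hasSum_sinh (c * ⟪p i, p j⟫) using 2 with k
      have : δ k i * δ k j = 1 := by
        simp only [hδ, h]
        split_ifs
        · simp
        · rw [← pow_add, ← two_mul, pow_mul]; simp
      rw [this, one_mul]
    · convert Real.hasSum_sin (c * ⟪p i, p j⟫) using 2 with k
      have : δ k i * δ k j = (-1) ^ k := by
        simp only [hδ]
        rcases i with i | i <;> rcases j with j | j <;> simp at h ⊢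
      rw [this, mul_div_assoc]
  have hsum : HasSum (fun k : ℕ => ∑ i, ∑ j, x i * x j * (δ k i * δ k j *
      ((c * ⟪p i, p j⟫) ^ (2 * k + 1) / (2 * k + 1).factorial)))
      (∑ i, ∑ j, x i * x j * krivineMatrix c p i j) :=
    hasSum_sum fun i _ => hasSum_sum fun j _ => (hM i j).mul_left _
  have hq : star x ⬝ᵥ (krivineMatrix c p).mulVec x =
      ∑ i, ∑ j, x i * x j * krivineMatrix c p i j := by
    simp only [dotProduct, Matrix.mulVec, Finset.mul_sum, star_trivial]
    refine Finset.sum_congr rfl fun i _ => Finset.sum_congr rfl fun j _ => by ring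
  rw [hq]
  refine hsum.nonneg fun k => ?_
  have : ∑ i, ∑ j, x i * x j * (δ k i * δ k j *
      ((c * ⟪p i, p j⟫) ^ (2 * k + 1) / (2 * k + 1).factorial)) =
      c ^ (2 * k + 1) / (2 * k + 1).factorial *
        ∑ i, ∑ j, (x i * δ k i) * (x j * δ k j) * ⟪p i, p j⟫ ^ (2 * k + 1) := by
    simp only [Finset.mul_sum]
    refine Finset.sum_congr rfl fun i _ => Finset.sum_congr rfl fun j _ => ?_
    rw [mul_pow]
    ring
  rw [this]
  exact mul_nonneg (by positivity) (sum_mul_inner_pow_nonneg p _ _)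

/-! ### Sign correlations of Gaussian vectors. -/

/-- Two coordinates of unit variance of a centred Gaussian vector, in terms of a standard pair. -/
theorem multivariateGaussian_map_pair {ι : Type*} [Fintype ι] [DecidableEq ι]
    {S : Matrix ι ι ℝ} (hS : S.PosSemidef) {i j : ι} {θ : ℝ} (hi : S i i = 1) (hj : S j j = 1)
    (hij : S i j = Real.sin θ) :
    (multivariateGaussian 0 S).map (fun g => (g i, g j)) =
      ((gaussianReal 0 1).prod (gaussianReal 0 1)).map
        (fun z => (z.1, Real.sin θ * z.1 + Real.cos θ * z.2)) := by
  have hji : S j i = Real.sin θ := by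
    rw [← hij]; simpa using hS.1.apply i j
  apply Measure.ext_of_charFunDual
  ext L
  set a := L (1, 0) with ha
  set b := L (0, 1) with hb
  have hL (x y : ℝ) : L (x, y) = a * x + b * y := by
    have : (x, y) = x • ((1 : ℝ), (0 : ℝ)) + y • ((0 : ℝ), (1 : ℝ)) := by simp
    rw [this, map_add, map_smul, map_smul, smul_eq_mul, smul_eq_mul, mul_comm x, mul_comm y]
  have h1 : charFunDual ((multivariateGaussian 0 S).map (fun g => (g i, g j))) L =
      charFun (multivariateGaussian 0 S)
        (EuclideanSpace.single i a + EuclideanSpace.single j b) := by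
    rw [charFunDual_apply, integral_map (by fun_prop) (by fun_prop), charFun_apply]
    refine integral_congr_ae (Filter.Eventually.of_forall fun g => ?_)
    simp only [hL, inner_add_right, EuclideanSpace.inner_single_right]
    simp
  have h2 : charFunDual (((gaussianReal 0 1).prod (gaussianReal 0 1)).map
        (fun z => (z.1, Real.sin θ * z.1 + Real.cos θ * z.2))) L =
      charFun (gaussianReal 0 1) (a + b * Real.sin θ) * charFun (gaussianReal 0 1)
        (b * Real.cos θ) := by
    rw [charFunDual_apply, integral_map (by fun_prop) (by fun_prop), charFun_apply_real,
      charFun_apply_real, ← integral_prod_mul]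
    refine integral_congr_ae (Filter.Eventually.of_forall fun z => ?_)
    simp only [hL, ← Complex.exp_add]
    congr 1
    push_cast
    ring
  rw [h1, h2, charFun_multivariateGaussian hS, charFun_gaussianReal, charFun_gaussianReal,
    ← Complex.exp_add]
  congr 1
  have hq : (EuclideanSpace.single i a + EuclideanSpace.single j b : EuclideanSpace ℝ ι).ofLp ⬝ᵥ
      S.mulVec (EuclideanSpace.single i a + EuclideanSpace.single j b : EuclideanSpace ℝ ι).ofLp =
      a ^ 2 + 2 * (a * b * Real.sin θ) + b ^ 2 := by
    simp [Matrix.mulVec_add, hi, hj, hij, hji, add_dotProduct]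
    ring
  rw [hq]
  have hc : (Complex.cos θ) ^ 2 = 1 - Complex.sin θ ^ 2 := Complex.cos_sq' _
  push_cast
  simp only [inner_zero_right, mul_pow, hc]
  push_cast
  ring

/-- The expectation of a positively homogeneous function of degree zero of a standard Gaussian
pair is its average over the circle. -/
theorem integral_gaussianReal_prod_of_homogeneous (f : ℝ × ℝ → ℝ)
    (hf : ∀ r : ℝ, 0 < r → ∀ x y, f (r * x, r * y) = f (x, y)) :
    ∫ z, f z ∂((gaussianReal 0 1).prod (gaussianReal 0 1)) =
      (2 * Real.pi)⁻¹ * ∫ φ in (-Real.pi)..Real.pi, f (Real.cos φ, Real.sin φ) := by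
  have key (f : ℝ × ℝ → ℝ) (hf : ∀ r : ℝ, 0 < r → ∀ x y, f (r * x, r * y) = f (x, y)) :
      ∫ z, f z ∂((gaussianReal 0 1).prod (gaussianReal 0 1)) =
      (∫ r in Set.Ioi (0 : ℝ), r * ((2 * Real.pi)⁻¹ * Real.exp (-r ^ 2 / 2))) *
        ∫ φ in (-Real.pi)..Real.pi, f (Real.cos φ, Real.sin φ) := by
    rw [gaussianReal_of_var_ne_zero 0 one_ne_zero,
      prod_withDensity (measurable_gaussianPDF _ _) (measurable_gaussianPDF _ _),
      integral_withDensity_eq_integral_toReal_smul₀ (by fun_prop)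
        (Filter.Eventually.of_forall fun z => ENNReal.mul_lt_top (by simp [gaussianPDF])
          (by simp [gaussianPDF])),
      ← Measure.volume_eq_prod, ← integral_comp_polarCoord_symm, polarCoord_target,
      intervalIntegral.integral_of_le (by linarith [Real.pi_pos]), integral_Ioc_eq_integral_Ioo,
      ← setIntegral_prod_mul, ← Measure.volume_eq_prod]
    refine setIntegral_congr_fun (measurableSet_Ioi.prod measurableSet_Ioo) fun p hp => ?_
    have hp1 : 0 < p.1 := hp.1
    simp only [polarCoord_symm_apply, ENNReal.toReal_mul, toReal_gaussianPDF, smul_eq_mul,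
      hf _ hp1, gaussianPDFReal, NNReal.coe_one, mul_one, sub_zero]
    have hsq : (√(2 * Real.pi))⁻¹ * (√(2 * Real.pi))⁻¹ = (2 * Real.pi)⁻¹ := by
      rw [← mul_inv, Real.mul_self_sqrt (by positivity)]
    have hexp : Real.exp (-(p.1 * Real.cos p.2) ^ 2 / 2) *
        Real.exp (-(p.1 * Real.sin p.2) ^ 2 / 2) = Real.exp (-p.1 ^ 2 / 2) := by
      rw [← Real.exp_add]
      congr 1
      linear_combination (-p.1 ^ 2 / 2) * Real.sin_sq_add_cos_sq p.2
    rw [← hsq, ← hexp]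
    ring
  -- The constant function `1` gives the value of the radial integral without computing it.
  have h1 := key (fun _ => 1) (fun _ _ _ _ => rfl)
  simp only [integral_const, probReal_univ, intervalIntegral.integral_const, smul_eq_mul,
    mul_one] at h1
  rw [key f hf, eq_inv_of_mul_eq_one_left h1.symm]
  congr 2
  ring

theorem measurable_coe_sign : Measurable fun x : ℝ => (SignType.sign x : ℝ) := by
  have : (fun x : ℝ => (SignType.sign x : ℝ)) =
      fun x => if 0 < x then 1 else if x < 0 then -1 else 0 := by
    ext x
    rw [sign_apply]
    split_ifs <;> simp
  rw [this]
  exact Measurable.ite measurableSet_Ioi measurable_const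
    (Measurable.ite measurableSet_Iio measurable_const measurable_const)

/-- Both factors change sign under a shift by `π`, so the integral is twice that over `(-π/2, π/2)`.
There the cosine is positive, and `sin (φ + θ)` is negative on a length `π/2 - θ` and positive on a
length `π/2 + θ`. -/
theorem integral_sign_cos_mul_sign_sin_add {θ : ℝ} (h1 : -(Real.pi / 2) ≤ θ)
    (h2 : θ ≤ Real.pi / 2) :
    ∫ φ in (-Real.pi)..Real.pi,
      (SignType.sign (Real.cos φ) : ℝ) * (SignType.sign (Real.sin (φ + θ)) : ℝ) = 4 * θ := by
  have hπ := Real.pi_pos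
  set f : ℝ → ℝ := fun φ =>
    (SignType.sign (Real.cos φ) : ℝ) * (SignType.sign (Real.sin (φ + θ)) : ℝ) with hf
  have hper : Function.Periodic f Real.pi := fun φ => by
    simp only [hf, Real.cos_add_pi, add_right_comm φ Real.pi θ, Real.sin_add_pi, Left.sign_neg]
    simp
  have hpos (a b : ℝ) (ha : 0 ≤ a) (hab : a ≤ b) (hb : b ≤ Real.pi) :
      ∫ ψ in a..b, (SignType.sign (Real.sin ψ) : ℝ) = b - a := by
    rw [intervalIntegral.integral_of_le hab, integral_Ioc_eq_integral_Ioo,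
      setIntegral_congr_fun (g := fun _ => (1 : ℝ)) measurableSet_Ioo fun ψ hψ => by
        simp [sign_pos (Real.sin_pos_of_pos_of_lt_pi (ha.trans_lt hψ.1) (hψ.2.trans_le hb))]]
    simp [hab]
  have hneg (a b : ℝ) (ha : -Real.pi ≤ a) (hab : a ≤ b) (hb : b ≤ 0) :
      ∫ ψ in a..b, (SignType.sign (Real.sin ψ) : ℝ) = a - b := by
    have := hpos (-b) (-a) (by linarith) (by linarith) (by linarith)
    rw [← intervalIntegral.integral_comp_neg] at this
    simp only [Real.sin_neg, Left.sign_neg, SignType.coe_neg, intervalIntegral.integral_neg] at this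
    linarith
  have hmeas : Measurable (fun ψ : ℝ => (SignType.sign (Real.sin ψ) : ℝ)) :=
    measurable_coe_sign.comp Real.measurable_sin
  have hmeasf : Measurable f :=
    (measurable_coe_sign.comp Real.measurable_cos).mul
      (measurable_coe_sign.comp (Real.measurable_sin.comp (measurable_add_const θ)))
  have habs (s : SignType) : |(s : ℝ)| ≤ 1 := by cases s <;> simp
  have hint (a b : ℝ) : IntervalIntegrable (fun ψ : ℝ => (SignType.sign (Real.sin ψ) : ℝ))
      volume a b :=
    (intervalIntegrable_const (c := (1 : ℝ))).mono_fun hmeas.aestronglyMeasurable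
      (Filter.Eventually.of_forall fun _ => by simpa using habs _)
  have hintf (a b : ℝ) : IntervalIntegrable f volume a b :=
    (intervalIntegrable_const (c := (1 : ℝ))).mono_fun hmeasf.aestronglyMeasurable
      (Filter.Eventually.of_forall fun _ => by
        simpa [hf, abs_mul] using mul_le_one₀ (habs _) (abs_nonneg _) (habs _))
  have hhalf : ∫ φ in (-(Real.pi / 2))..(Real.pi / 2), f φ = 2 * θ := by
    rw [intervalIntegral.integral_of_le (by linarith), integral_Ioc_eq_integral_Ioo,
      setIntegral_congr_fun (g := fun φ => (SignType.sign (Real.sin (φ + θ)) : ℝ))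
        measurableSet_Ioo fun φ hφ => by
          simp [hf, sign_pos (Real.cos_pos_of_mem_Ioo hφ)],
      ← integral_Ioc_eq_integral_Ioo, ← intervalIntegral.integral_of_le (by linarith),
      intervalIntegral.integral_comp_add_right (fun ψ => (SignType.sign (Real.sin ψ) : ℝ)),
      ← intervalIntegral.integral_add_adjacent_intervals (hint _ 0) (hint 0 _),
      hneg _ _ (by linarith) (by linarith) le_rfl, hpos _ _ le_rfl (by linarith) (by linarith)]
    ring
  have hshift (t : ℝ) : ∫ φ in t..(t + Real.pi), f φ = 2 * θ := by
    rw [hper.intervalIntegral_add_eq t (-(Real.pi / 2)), ← hhalf]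
    congr 1
    ring
  rw [← intervalIntegral.integral_add_adjacent_intervals (hintf (-Real.pi) 0) (hintf 0 _)]
  have e1 := hshift (-Real.pi)
  have e2 := hshift 0
  rw [neg_add_cancel] at e1
  rw [zero_add] at e2
  linarith

/-- Grothendieck's identity: if `g i`, `g j` are standard Gaussian with covariance `sin θ`, then
`E[sign (g i) sign (g j)] = 2 θ / π`. -/
theorem integral_sign_mul_sign_multivariateGaussian {ι : Type*} [Fintype ι] [DecidableEq ι]
    {S : Matrix ι ι ℝ} (hS : S.PosSemidef) {i j : ι} {θ : ℝ} (hi : S i i = 1) (hj : S j j = 1)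
    (hij : S i j = Real.sin θ) (h1 : -(Real.pi / 2) ≤ θ) (h2 : θ ≤ Real.pi / 2) :
    ∫ g, (SignType.sign (g i) : ℝ) * (SignType.sign (g j) : ℝ) ∂(multivariateGaussian 0 S) =
      2 / Real.pi * θ := by
  have hm : Measurable (fun z : ℝ × ℝ => (SignType.sign z.1 : ℝ) * (SignType.sign z.2 : ℝ)) :=
    (measurable_coe_sign.comp measurable_fst).mul (measurable_coe_sign.comp measurable_snd)
  have e1 := integral_map (μ := multivariateGaussian 0 S) (φ := fun g => (g i, g j))
    (by fun_prop) hm.aestronglyMeasurable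
  rw [multivariateGaussian_map_pair hS hi hj hij, integral_map (by fun_prop)
    hm.aestronglyMeasurable, integral_gaussianReal_prod_of_homogeneous] at e1
  · rw [← e1]
    have (φ : ℝ) : Real.sin θ * Real.cos φ + Real.cos θ * Real.sin φ = Real.sin (φ + θ) := by
      rw [Real.sin_add]; ring
    simp only [this]
    rw [integral_sign_cos_mul_sign_sin_add h1 h2]
    field_simp
    ring
  · intro r hr x y
    have : Real.sin θ * (r * x) + Real.cos θ * (r * y) =
        r * (Real.sin θ * x + Real.cos θ * y) := by ring
    simp [this, sign_mul, sign_pos hr]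

/-! ### Grothendieck's inequality with Krivine's constant. -/

/-- Turns the Gaussian average into a finite convex combination, as tensor decompositions must be
finite. -/
theorem integral_comp_eq_sum_preimage {Ω T : Type*} [MeasurableSpace Ω] (μ : Measure Ω)
    [IsFiniteMeasure μ] [Fintype T] (S : Ω → T) (hS : ∀ t, MeasurableSet (S ⁻¹' {t})) (f : T → ℝ) :
    ∫ ω, f (S ω) ∂μ = ∑ t, μ.real (S ⁻¹' {t}) * f t := by
  classical
  have h (ω : Ω) : f (S ω) = ∑ t, (S ⁻¹' {t}).indicator (fun _ => f t) ω := by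
    simp [Set.indicator_apply]
  simp only [h]
  rw [integral_finsetSum _ fun t _ => (integrable_const _).indicator (hS t)]
  refine Finset.sum_congr rfl fun t _ => ?_
  rw [integral_indicator_const _ (hS t), smul_eq_mul]

/-- Grothendieck's inequality with Krivine's constant, as a representation of the matrix of inner
products by a convex combination of sign matrices. -/
theorem exists_sign_representation_inner {I J κ : Type*} [Fintype I] [Fintype J] [Fintype κ]
    [DecidableEq I] [DecidableEq J] (w : I ⊕ J → EuclideanSpace ℝ κ) :
    ∃ p : (I ⊕ J → SignType) → ℝ, (∀ s, 0 ≤ p s) ∧ ∑ s, p s = 1 ∧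
      ∀ i j, ⟪w (.inl i), w (.inr j)⟫ = Real.pi / (2 * Real.log (1 + √2)) *
        ∑ s, p s * ((‖w (.inl i)‖ * s (.inl i)) * (‖w (.inr j)‖ * s (.inr j))) := by
  have h2 : (0 : ℝ) < √2 := by positivity
  set c : ℝ := Real.log (1 + √2) with hc
  have hc0 : 0 < c := Real.log_pos (by linarith)
  -- This choice of `c` gives unit variances at unit vectors.
  have hsinh : Real.sinh c = 1 := by
    have : c = Real.arsinh 1 := by
      rw [hc, Real.arsinh]
      norm_num
    rw [this, Real.sinh_arsinh]
  -- Keeps the angles `c * ⟪q i, q j⟫` where `arcsin` inverts `sin`.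
  have hcπ : c ≤ Real.pi / 2 := by
    have h3 := Real.log_le_sub_one_of_pos (x := 1 + √2) (by linarith)
    have h4 : √2 ≤ 1.5 := Real.sqrt_le_iff.2 (by norm_num)
    have := Real.pi_gt_three
    linarith
  set q : I ⊕ J → EuclideanSpace ℝ κ := fun i => ‖w i‖⁻¹ • w i with hq
  have hM := krivineMatrix_posSemidef hc0.le q
  set μ := multivariateGaussian 0 (krivineMatrix c q)
  let S : EuclideanSpace ℝ (I ⊕ J) → I ⊕ J → SignType := fun g i => SignType.sign (g i)
  have hS (t : I ⊕ J → SignType) : MeasurableSet (S ⁻¹' {t}) := by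
    have : S ⁻¹' {t} = ⋂ i, {g | (SignType.sign (g i) : ℝ) = t i} := by
      have hinj (a b : SignType) : (a : ℝ) = b ↔ a = b := by
        cases a <;> cases b <;> norm_num; decide
      ext g
      simp only [S, hinj, Set.mem_preimage, Set.mem_singleton_iff, funext_iff, Set.mem_iInter,
        Set.mem_ofPred_eq]
    rw [this]
    refine MeasurableSet.iInter fun i => ?_
    exact (measurable_coe_sign.comp (by fun_prop : Measurable fun g : EuclideanSpace ℝ (I ⊕ J) =>
      g i)) (measurableSet_singleton _)
  have hint := integral_comp_eq_sum_preimage μ S hS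
  refine ⟨fun s => μ.real (S ⁻¹' {s}), fun s => measureReal_nonneg, ?_, fun i j => ?_⟩
  · simpa using (hint fun _ => 1).symm
  rw [← hint fun s => (‖w (.inl i)‖ * s (.inl i)) * (‖w (.inr j)‖ * s (.inr j))]
  have hfactor : ∫ g, (‖w (.inl i)‖ * S g (.inl i)) * (‖w (.inr j)‖ * S g (.inr j)) ∂μ =
      ‖w (.inl i)‖ * ‖w (.inr j)‖ *
        ∫ g, (SignType.sign (g (.inl i)) : ℝ) * (SignType.sign (g (.inr j)) : ℝ) ∂μ := by
    rw [← integral_const_mul]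
    exact integral_congr_ae (Filter.Eventually.of_forall fun g => mul_mul_mul_comm _ _ _ _)
  rw [hfactor]
  -- A zero vector normalizes to `0`, so its variance is not `1`; but then both sides vanish.
  rcases eq_or_ne (w (.inl i)) 0 with hi | hi
  · simp [hi]
  rcases eq_or_ne (w (.inr j)) 0 with hj | hj
  · simp [hj]
  have hn (k : I ⊕ J) (hk : w k ≠ 0) : ‖q k‖ = 1 := by
    have := norm_ne_zero_iff.2 hk
    simp [hq, norm_smul, this]
  have hdiag (k : I ⊕ J) (hk : w k ≠ 0) : krivineMatrix c q k k = 1 := by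
    simp [krivineMatrix, hn k hk, hsinh]
  have habs : |⟪q (.inl i), q (.inr j)⟫| ≤ 1 := by
    simpa [hn _ hi, hn _ hj] using abs_real_inner_le_norm (q (.inl i)) (q (.inr j))
  obtain ⟨hl, hr⟩ := abs_le.1 habs
  rw [integral_sign_mul_sign_multivariateGaussian hM (hdiag _ hi) (hdiag _ hj)
    (θ := c * ⟪q (.inl i), q (.inr j)⟫) (by simp [krivineMatrix]) (by nlinarith) (by nlinarith)]
  have hni := norm_ne_zero_iff.2 hi
  have hnj := norm_ne_zero_iff.2 hj
  have hπ := Real.pi_ne_zero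
  have hc1 := hc0.ne'
  simp only [hq, real_inner_smul_left, real_inner_smul_right]
  field_simp

/-! ### Bounds for the two tensor norms. -/

section TensorNorms

variable {E F : Type*} [NormedAddCommGroup E] [NormedSpace ℝ E] [NormedAddCommGroup F]
  [NormedSpace ℝ F]

theorem le_weakTwoNorm {n : ℕ} (u : Fin n → E) (G : E →L[ℝ] ℝ) (hG : ‖G‖ ≤ 1) :
    √(∑ i, |G (u i)| ^ 2) ≤ weakTwoNorm u := by
  refine le_csSup ⟨√(∑ i, ‖u i‖ ^ 2), ?_⟩ ⟨G, hG, rfl⟩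
  rintro r ⟨G, hG, rfl⟩
  refine Real.sqrt_le_sqrt (Finset.sum_le_sum fun i _ => ?_)
  have : |G (u i)| ≤ ‖u i‖ := by simpa using G.le_of_opNorm_le hG (u i)
  gcongr

theorem weakTwoNorm_nonneg {n : ℕ} (u : Fin n → E) : 0 ≤ weakTwoNorm u :=
  (Real.sqrt_nonneg _).trans (le_weakTwoNorm u 0 (by simp))

theorem projectiveTensorNorm_sum_tmul_le {T : Type*} [Fintype T] (u : T → E) (v : T → F) :
    projectiveTensorNorm (∑ t, u t ⊗ₜ[ℝ] v t) ≤ ∑ t, ‖u t‖ * ‖v t‖ := by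
  refine csInf_le ⟨0, ?_⟩ ⟨Fintype.card T, u ∘ (Fintype.equivFin T).symm,
    v ∘ (Fintype.equivFin T).symm, ?_, ?_⟩
  · rintro r ⟨n, u, v, -, rfl⟩
    positivity
  · exact ((Fintype.equivFin T).symm.sum_comp fun t => u t ⊗ₜ[ℝ] v t).symm
  · exact ((Fintype.equivFin T).symm.sum_comp fun t => ‖u t‖ * ‖v t‖).symm

theorem le_mul_hilbertianTensorNorm {P : E ⊗[ℝ] F} {C r : ℝ} (hC : 0 ≤ C)
    (h : ∀ (n : ℕ) (u : Fin n → E) (v : Fin n → F), P = ∑ i, u i ⊗ₜ[ℝ] v i →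
      r ≤ C * (weakTwoNorm u * weakTwoNorm v)) :
    r ≤ C * hilbertianTensorNorm P := by
  obtain ⟨s, hs⟩ := TensorProduct.exists_finset P
  -- Nonemptiness matters: the real `sInf` of the empty set is `0`.
  have hne : {r : ℝ | ∃ (n : ℕ) (u : Fin n → E) (v : Fin n → F),
      P = ∑ i, u i ⊗ₜ[ℝ] v i ∧ r = weakTwoNorm u * weakTwoNorm v}.Nonempty := by
    refine ⟨_, s.card, fun i => (s.equivFin.symm i).1.1, fun i => (s.equivFin.symm i).1.2, ?_, rfl⟩
    rw [s.equivFin.symm.sum_comp fun i => i.1.1 ⊗ₜ[ℝ] i.1.2, hs]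
    exact (Finset.sum_coe_sort s fun i => i.1 ⊗ₜ[ℝ] i.2).symm
  rcases hC.eq_or_lt with rfl | hC
  · obtain ⟨_, n, u, v, hP, -⟩ := hne
    simpa using h n u v hP
  rw [← div_le_iff₀' hC]
  refine le_csInf hne ?_
  rintro _ ⟨n, u, v, hP, rfl⟩
  rw [div_le_iff₀' hC]
  exact h n u v hP

end TensorNorms

/-! ### Arrays, their entry vectors and their row sums. -/

section Arrays

variable {X A : Type*} [Fintype X] [Fintype A]

/-- The array with the given entries. -/
def LInftyL1.ofEntries (f : X → A → ℝ) : LInftyL1 X A :=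
  WithLp.toLp _ fun x => WithLp.toLp _ (f x)

theorem LInftyL1.norm_le_iff {P : LInftyL1 X A} {C : ℝ} (hC : 0 ≤ C) :
    ‖P‖ ≤ C ↔ ∀ x, ∑ a, |P x a| ≤ C := by
  have h (x : X) : ‖P x‖ = ∑ a, |P x a| := by
    simp [PiLp.norm_eq_sum (p := 1) (by simp)]
  simp only [← h]
  refine ⟨fun hP x => (PiLp.norm_apply_le P x).trans hP, fun hP => ?_⟩
  rw [PiLp.norm_eq_ciSup]
  exact Real.iSup_le hP hC

/-- The array with a single nonzero entry, equal to `1`. -/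
def LInftyL1.unit [DecidableEq X] [DecidableEq A] (k : X × A) : LInftyL1 X A :=
  LInftyL1.ofEntries fun x a => if (x, a) = k then 1 else 0

theorem LInftyL1.sum_smul_unit [DecidableEq X] [DecidableEq A] (P : LInftyL1 X A) :
    ∑ k : X × A, P k.1 k.2 • LInftyL1.unit k = P := by
  ext x a
  simp only [WithLp.ofLp_sum, Finset.sum_apply, LInftyL1.unit, LInftyL1.ofEntries,
    WithLp.ofLp_smul, Pi.smul_apply, smul_eq_mul, mul_ite, mul_one, mul_zero]
  rw [Finset.sum_eq_single (x, a)] <;> simp +contextual [eq_comm]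

/-- A finite sum of elementary tensors, expanded in the tensors of unit arrays. -/
theorem LInftyL1.sum_tmul_eq [DecidableEq X] [DecidableEq A] {Y B T : Type*} [Fintype Y]
    [Fintype B] [DecidableEq Y] [DecidableEq B] [Fintype T] (u : T → LInftyL1 X A)
    (v : T → LInftyL1 Y B) :
    ∑ t, u t ⊗ₜ[ℝ] v t = ∑ k : X × A, ∑ l : Y × B,
      (∑ t, u t k.1 k.2 * v t l.1 l.2) • (LInftyL1.unit k ⊗ₜ[ℝ] LInftyL1.unit l) := by
  simp only [Finset.sum_smul]
  refine Eq.trans ?_ ((Finset.sum_congr rfl fun k _ => Finset.sum_comm).trans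
    Finset.sum_comm).symm
  refine Finset.sum_congr rfl fun t _ => ?_
  conv_lhs => rw [← LInftyL1.sum_smul_unit (u t), ← LInftyL1.sum_smul_unit (v t)]
  rw [TensorProduct.sum_tmul]
  refine Finset.sum_congr rfl fun k _ => ?_
  rw [TensorProduct.tmul_sum]
  refine Finset.sum_congr rfl fun l _ => ?_
  rw [TensorProduct.smul_tmul_smul]

/-- A finite sum of elementary tensors is determined by its entries. -/
theorem LInftyL1.sum_tmul_eq_of_entries {Y B T T' : Type*} [Fintype Y] [Fintype B] [Fintype T]
    [Fintype T'] (u : T → LInftyL1 X A) (v : T → LInftyL1 Y B) (u' : T' → LInftyL1 X A)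
    (v' : T' → LInftyL1 Y B)
    (h : ∀ x a y b, ∑ t, u t x a * v t y b = ∑ t, u' t x a * v' t y b) :
    ∑ t, u t ⊗ₜ[ℝ] v t = ∑ t, u' t ⊗ₜ[ℝ] v' t := by
  classical
  rw [LInftyL1.sum_tmul_eq u v, LInftyL1.sum_tmul_eq u' v']
  simp only [h]

/-- The vectors formed by the entries of a finite family of arrays. -/
def LInftyL1.entryVector {n : ℕ} (u : Fin n → LInftyL1 X A) (k : X × A) :
    EuclideanSpace ℝ (Fin n) :=
  WithLp.toLp 2 fun i => u i k.1 k.2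

theorem LInftyL1.sum_norm_entryVector_le {n : ℕ} (u : Fin n → LInftyL1 X A) (x : X) :
    ∑ a, ‖LInftyL1.entryVector u (x, a)‖ ≤ √(Fintype.card A) * weakTwoNorm u := by
  obtain ⟨ε, hε, hle⟩ := exists_signs_sum_norm_sq_le Finset.univ
    fun a => LInftyL1.entryVector u (x, a)
  -- The signs on row `x` form a functional of norm at most `1`; its values on the `u i` are the
  -- coordinates of the signed sum of entry vectors.
  let G₀ : LInftyL1 X A →ₗ[ℝ] ℝ :=
    { toFun := fun P => ∑ a, ε a * P x a
      map_add' := fun P Q => by simp [mul_add, Finset.sum_add_distrib]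
      map_smul' := fun r P => by simp [Finset.mul_sum, mul_left_comm] }
  have hG₀ (P : LInftyL1 X A) : ‖G₀ P‖ ≤ 1 * ‖P‖ := by
    rw [one_mul]
    refine (norm_sum_le _ _).trans (le_trans (Finset.sum_le_sum fun a _ => ?_)
      ((LInftyL1.norm_le_iff (norm_nonneg P)).1 le_rfl x))
    rw [norm_mul, Real.norm_eq_abs, Real.norm_eq_abs]
    exact mul_le_of_le_one_left (abs_nonneg _) (hε a)
  have hG := le_weakTwoNorm u (G₀.mkContinuous 1 hG₀) (G₀.mkContinuous_norm_le zero_le_one hG₀)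
  have hsum : ∑ i, |G₀.mkContinuous 1 hG₀ (u i)| ^ 2 =
      ‖∑ a, ε a • LInftyL1.entryVector u (x, a)‖ ^ 2 := by
    rw [EuclideanSpace.real_norm_sq_eq]
    refine Finset.sum_congr rfl fun i _ => ?_
    simp [G₀, LInftyL1.entryVector]
  rw [hsum, Real.sqrt_sq (norm_nonneg _)] at hG
  have hcs := sq_sum_le_card_mul_sum_sq (s := Finset.univ)
    (f := fun a => ‖LInftyL1.entryVector u (x, a)‖)
  refine abs_le_of_sq_le_sq' ?_ (mul_nonneg (Real.sqrt_nonneg _) (weakTwoNorm_nonneg u)) |>.2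
  rw [mul_pow, Real.sq_sqrt (Nat.cast_nonneg _)]
  refine hcs.trans (mul_le_mul_of_nonneg_left (hle.trans ?_) (Nat.cast_nonneg _))
  exact pow_le_pow_left₀ (norm_nonneg _) hG 2

/-- The array of entries `‖U (x, a)‖ * s (x, a)`. -/
noncomputable def LInftyL1.signed {n : ℕ} (u : Fin n → LInftyL1 X A) (s : X × A → SignType) : LInftyL1 X A :=
  LInftyL1.ofEntries fun x a => ‖LInftyL1.entryVector u (x, a)‖ * s (x, a)

theorem LInftyL1.norm_signed_le {n : ℕ} (u : Fin n → LInftyL1 X A) (s : X × A → SignType) :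
    ‖LInftyL1.signed u s‖ ≤ √(Fintype.card A) * weakTwoNorm u := by
  refine (LInftyL1.norm_le_iff (mul_nonneg (Real.sqrt_nonneg _) (weakTwoNorm_nonneg u))).2
    fun x => (Finset.sum_le_sum fun a _ => ?_).trans (LInftyL1.sum_norm_entryVector_le u x)
  have habs (t : SignType) : |(t : ℝ)| ≤ 1 := by cases t <;> simp
  simpa [LInftyL1.signed, LInftyL1.ofEntries, abs_mul] using
    mul_le_of_le_one_right (norm_nonneg _) (habs (s (x, a)))

end Arrays

theorem mainTheorem2 {X Y A B : Type*} [Fintype X] [Fintype Y] [Fintype A] [Fintype B]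
    (P : LInftyL1 X A ⊗[ℝ] LInftyL1 Y B) :
    projectiveTensorNorm P ≤
      Real.pi / (2 * Real.log (1 + Real.sqrt 2)) *
        Real.sqrt ((Fintype.card A : ℝ) * (Fintype.card B : ℝ)) *
        hilbertianTensorNorm P := by
  classical
  have hK : 0 ≤ Real.pi / (2 * Real.log (1 + √2)) :=
    div_nonneg Real.pi_pos.le (mul_nonneg zero_le_two
      (Real.log_nonneg (le_add_of_nonneg_right (Real.sqrt_nonneg 2))))
  refine le_mul_hilbertianTensorNorm (mul_nonneg hK (Real.sqrt_nonneg _)) fun n u v hP => ?_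
  obtain ⟨p, hp0, hp1, hp⟩ := exists_sign_representation_inner
    (Sum.elim (LInftyL1.entryVector u) (LInftyL1.entryVector v))
  set K := Real.pi / (2 * Real.log (1 + √2))
  -- Comparing entries suffices; the weight `K * p s` is put on the left factor.
  have hrep : P = ∑ s, ((K * p s) • LInftyL1.signed u (s ∘ Sum.inl)) ⊗ₜ[ℝ]
      LInftyL1.signed v (s ∘ Sum.inr) := by
    rw [hP]
    refine LInftyL1.sum_tmul_eq_of_entries _ _ _ _ fun x a y b => ?_
    have h := hp (x, a) (y, b)
    simp only [Sum.elim_inl, Sum.elim_inr] at h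
    have hin : ∑ i, u i x a * v i y b =
        ⟪LInftyL1.entryVector u (x, a), LInftyL1.entryVector v (y, b)⟫ := by
      simp [PiLp.inner_apply, LInftyL1.entryVector, mul_comm]
    rw [hin, h, Finset.mul_sum]
    refine Finset.sum_congr rfl fun s _ => ?_
    simp [LInftyL1.signed, LInftyL1.ofEntries]
    ring
  rw [hrep]
  refine (projectiveTensorNorm_sum_tmul_le _ _).trans ?_
  calc ∑ s, ‖(K * p s) • LInftyL1.signed u (s ∘ Sum.inl)‖ * ‖LInftyL1.signed v (s ∘ Sum.inr)‖
      ≤ ∑ s, (K * p s) * ((√(Fintype.card A) * weakTwoNorm u) *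
          (√(Fintype.card B) * weakTwoNorm v)) := by
        refine Finset.sum_le_sum fun s _ => ?_
        have hs : 0 ≤ K * p s := mul_nonneg hK (hp0 s)
        rw [norm_smul, Real.norm_of_nonneg hs, mul_assoc]
        refine mul_le_mul_of_nonneg_left ?_ hs
        exact mul_le_mul (LInftyL1.norm_signed_le u _) (LInftyL1.norm_signed_le v _)
          (norm_nonneg _) (mul_nonneg (Real.sqrt_nonneg _) (weakTwoNorm_nonneg u))
    _ = K * √((Fintype.card A : ℝ) * (Fintype.card B : ℝ)) * (weakTwoNorm u * weakTwoNorm v) := by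
        rw [← Finset.sum_mul, ← Finset.mul_sum, hp1, Real.sqrt_mul (Nat.cast_nonneg _)]
        ring
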